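/- Definitions. All graphs are finite and simple; write $[m]=\{1,\dots,m\}$. The spectrum of a graph is the multiset of eigenvalues of its adjacency matrix, and two graphs are cospectral if they have the same spectrum. A regular graph is co-edge-regular with parameter $\mu$ if any two distinct non-adjacent vertices have exactly $\mu$ common neighbours; it has level $t$ if the number of common neighbours of two adjacent vertices takes exactly $t$ distinct values over all pairs of adjacent vertices. The $s$-clique extension of a graph $G$ has vertex set $V(G)\times[s]$, two distinct vertices $(x,a),(y,b)$ being adjacent if $x=y$ or $x\sim y$ in $G$. An orthogonal array $OA(N,t)$ is a $t\times N^2$ array with entries in $[N]$ and rows $r_1,\dots,r_t$ such that $\#\{(r_i(\ell),r_j(\ell)) : \ell\in[N^2]\}=N^2$ for $1\le i<j\le t$. Its Latin square graph $LS_t(N)$ (defined here for $t\ge 3$) has the $N^2$ columns of the array as vertices, two different columns being adjacent if they agree in some row. A group-divisible orthogonal array $GOA(n,s,t)$ consists of rows $r^i_j\in[n]^{n^2}$ ($i\in[t]$, $j\in[s]$; repetitions among $r^i_1,\dots,r^i_s$ are allowed) such that $\#\{(r^i_a(\ell),r^j_b(\ell)) : \ell\in[n^2]\}=n^2$ for all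 $i\ne j$ in $[t]$ and all $a,b\in[s]$. Let $q$ be a prime power and $n$ a positive integer. Suppose we are given - a $GOA(n,q,q+1)$ with rows $r^i_j$ ($i\in[q+1]$, $j\in[q]$), and - affine planes $P^i_j\subset\mathbb F_q^3$ ($i\in[q+1]$, $j\in[q]$) such that for each $i$ the planes $P^i_1,\dots,P^i_q$ are pairwise disjoint, any two planes $P^i_a,P^j_b$ with $i\ne j$ meet in exactly $q$ points, and any three planes $P^h_a,P^i_b,P^j_c$ with $h,i,j$ pairwise distinct meet in exactly one point. The associated twisted Latin square graph $TLS(q,n)$ has vertex set $\mathbb F_q^3\times[n^2]$, and two distinct vertices $(\mathbf x,i)$, $(\mathbf y,j)$ are adjacent if $i=j$ or if there are $s\in[q+1]$ and $t\in[q]$ with $\mathbf x,\mathbf y\in P^s_t$ and $r^s_t(i)=r^s_t(j)$. Theorem. Let $q$ be a prime power. There are infinitely many positive integers $n$ for which a twisted Latin square graph $TLS(q,n)$ exists, that is, for which such an array and such planes exist. Moreover, for every positive integer $n$, every twisted Latin square graph $TLS(q,n)$ (for any choice of the array and of the planes) satisfies the following. 1. $TLS(q,n)$ is co-edge-regular with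 parameter $\mu=(q+1)q^2$, and if $n\ge 2$ its level is $3$. 2. Its spectrum is $$\{(q^3-1+q^2(q+1)(n-1))^{1},\ (q^2(n-1)-1)^{(qn-1)(q+1)},\ (-1)^{(q-1)q^2n^2},\ (-q^2-1)^{(qn-1)(n-1)q}\},$$ where exponents denote multiplicities (which are added when listed values coincide). 3. $TLS(q,n)$ is cospectral with the $q$-clique extension of every Latin square graph $LS_{q+1}(qn)$. -/

import Mathlib

namespace TwistedLatin

section Graphs

variable {V : Type*} [Fintype V]

open Classical in
/-- The spectrum of a finite graph: the eigenvalues of its adjacency matrix, listed with their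
multiplicities (the adjacency matrix is real symmetric, so all eigenvalues are real). -/
noncomputable def spectrum (G : SimpleGraph V) : Multiset ℝ :=
  (G.adjMatrix ℝ).charpoly.roots

/-- Two finite graphs are cospectral if they have the same spectrum. -/
def Cospectral {W : Type*} [Fintype W] (G : SimpleGraph V) (H : SimpleGraph W) : Prop :=
  spectrum G = spectrum H

open Classical in
/-- A regular graph is co-edge-regular with parameter `μ` if any two distinct non-adjacent
vertices have exactly `μ` common neighbours. -/
def IsCoEdgeRegular (G : SimpleGraph V) (μ : ℕ) : Prop :=
  (∃ k : ℕ, G.IsRegularOfDegree k) ∧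
    ∀ x y : V, x ≠ y → ¬ G.Adj x y → (G.commonNeighbors x y).ncard = μ

/-- The level of a (co-edge-regular) graph: the number of distinct values taken by the number
`λ(x, y)` of common neighbours of adjacent vertices `x`, `y`. -/
noncomputable def level (G : SimpleGraph V) : ℕ :=
  {l : ℕ | ∃ x y : V, G.Adj x y ∧ (G.commonNeighbors x y).ncard = l}.ncard

end Graphs

/-- The `s`-clique extension of `G`: every vertex `x` is replaced by the clique
`{x} × Fin s`, and vertices of different cliques are adjacent iff the original vertices are. -/
def cliqueExtension {V : Type*} (s : ℕ) (G : SimpleGraph V) : SimpleGraph (V × Fin s) where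
  Adj a b := a ≠ b ∧ (a.1 = b.1 ∨ G.Adj a.1 b.1)
  symm := ⟨fun _ _ h => ⟨h.1.symm, h.2.imp Eq.symm SimpleGraph.Adj.symm⟩⟩
  loopless := ⟨fun _ h => h.1 rfl⟩

/-- `O` is an orthogonal array `OA(n, t)`: a `t × n²` array with entries in an `n`-set such that
any two rows with different indices, read column by column, show exactly `n²` different pairs. -/
def IsOrthogonalArray (n t : ℕ) (O : Fin t → Fin (n ^ 2) → Fin n) : Prop :=
  ∀ i j : Fin t, i < j →
    (Finset.univ.image fun l : Fin (n ^ 2) => (O i l, O j l)).card = n ^ 2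

/-- `O` is a group-divisible orthogonal array `GOA(n, s, t)`: there are `t` groups of `s` rows
(`O i a` is the `a`-th row of the `i`-th group; rows of one group may coincide), and any two rows
from different groups show exactly `n²` different pairs. -/
def IsGroupDivisibleOA (n s t : ℕ) (O : Fin t → Fin s → Fin (n ^ 2) → Fin n) : Prop :=
  ∀ i j : Fin t, i ≠ j → ∀ a b : Fin s,
    (Finset.univ.image fun l : Fin (n ^ 2) => (O i a l, O j b l)).card = n ^ 2

/-- The Latin square graph of an orthogonal array: its vertices are the columns, and two different
columns are adjacent iff they agree in some row. -/
def latinSquareGraph {n t : ℕ} (O : Fin t → Fin (n ^ 2) → Fin n) :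
    SimpleGraph (Fin (n ^ 2)) where
  Adj i j := i ≠ j ∧ ∃ l : Fin t, O l i = O l j
  symm := ⟨fun _ _ h => ⟨h.1.symm, h.2.imp fun _ hl => hl.symm⟩⟩
  loopless := ⟨fun _ h => h.1 rfl⟩

section Planes

variable {F : Type*} [Field F]

/-- An affine plane of `F³`. -/
def IsPlane (P : AffineSubspace F (Fin 3 → F)) : Prop :=
  (P : Set (Fin 3 → F)).Nonempty ∧ Module.finrank F P.direction = 2

/-- `P i 0, …, P i (q - 1)`, for `i = 0, …, q`, are `q + 1` parallel classes of planes of `F³`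
such that planes of two different classes meet in exactly `q` points and planes of three different
classes meet in exactly one point. -/
structure IsPlaneSystem (q : ℕ) (P : Fin (q + 1) → Fin q → AffineSubspace F (Fin 3 → F)) :
    Prop where
  isPlane : ∀ i a, IsPlane (P i a)
  parallel : ∀ i a b, a ≠ b → Disjoint (P i a : Set (Fin 3 → F)) (P i b : Set (Fin 3 → F))
  card_inter_two : ∀ i j, i ≠ j → ∀ a b,
    ((P i a : Set (Fin 3 → F)) ∩ (P j b : Set (Fin 3 → F))).ncard = q
  card_inter_three : ∀ h i j, h < i → i < j → ∀ a b c,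
    ((P h a : Set (Fin 3 → F)) ∩ (P i b : Set (Fin 3 → F)) ∩
      (P j c : Set (Fin 3 → F))).ncard = 1

/-- The twisted Latin square graph `TLS(q, n)` given by the planes `P i a` and the rows `O i a`. -/
def twistedLatinSquareGraph {q n : ℕ} (P : Fin (q + 1) → Fin q → AffineSubspace F (Fin 3 → F))
    (O : Fin (q + 1) → Fin q → Fin (n ^ 2) → Fin n) :
    SimpleGraph ((Fin 3 → F) × Fin (n ^ 2)) where
  Adj u v := u ≠ v ∧
    (u.2 = v.2 ∨ ∃ i a, u.1 ∈ P i a ∧ v.1 ∈ P i a ∧ O i a u.2 = O i a v.2)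
  symm := ⟨fun _ _ h => ⟨h.1.symm, h.2.imp Eq.symm
    fun ⟨i, a, hu, hv, hr⟩ => ⟨i, a, hv, hu, hr.symm⟩⟩⟩
  loopless := ⟨fun _ h => h.1 rfl⟩

end Planes

end TwistedLatin

/-! Both families of graphs have adjacency matrix A = S + K - 1. Here S counts agreements in a net
with q + 1 classes of qn blocks, two blocks of different classes meeting in q points, and K corrects
S inside cliques. For the twisted graph, a block is a plane together with a symbol in the row
attached to it, and K = (J - N) ⊗ I with N the agreement matrix of the plane system. For the clique
extension, the net pulls back the rows of the array, and K = I ⊗ (-qJ).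

Both decompositions obey the same relations, collected in `IsNetGraph`: S² is a combination of S and
J, SK = KS = -q²S, K² = -q²K, and tr K = -q|V|. These determine the spectrum in terms of q and n
alone (`IsNetGraph.spectrum_eq`), so cospectrality is immediate. They also make A² a combination of
S, J, A and I, so the number of common neighbours depends only on equality, adjacency and the entry
of S (`IsNetGraph.ncard_commonNeighbors`). In the twisted graph that entry is 0 on distinct
non-adjacent pairs, and takes exactly the values 0, 1, 2 on edges when n ≥ 2, which gives
co-edge-regularity and level 3.

For existence, planes come from a dual conic and arrays from the lines of an affine plane over F^k,
so n runs over the powers of q. -/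

namespace TwistedLatin

open Finset Matrix

/-! ### Spectrum from a resolution of the identity -/

section Eigenvalues

open Classical in
/-- If a real symmetric matrix acts as a scalar on each of several matrices whose sum is the
identity, then the traces of those matrices are the multiplicities of the scalars in the
spectrum. -/
theorem roots_charpoly_of_sum_eq_one {V ι : Type*} [Fintype V] [Fintype ι]
    {A : Matrix V V ℝ} (hA : A.IsHermitian) (E : ι → Matrix V V ℝ) (θ : ι → ℝ) (m : ι → ℕ)
    (hE : ∑ i, E i = 1) (hθ : ∀ i, A * E i = θ i • E i) (hm : ∀ i, (E i).trace = m i) :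
    A.charpoly.roots = ∑ i, Multiset.replicate (m i) (θ i) := by
  set U : Matrix V V ℝ := (hA.eigenvectorUnitary : Matrix V V ℝ) with hU
  have hUU : star U * U = 1 := Unitary.coe_star_mul_self hA.eigenvectorUnitary
  have hUU' : U * star U = 1 := Unitary.coe_mul_star_self hA.eigenvectorUnitary
  set D : Matrix V V ℝ := diagonal hA.eigenvalues with hD
  have hAD : A = U * D * star U := by
    have := hA.spectral_theorem
    rw [Unitary.conjStarAlgAut_apply] at this
    simpa using this
  -- In an eigenbasis, A E = θ E says that row v of E is killed by λ_v - θ. Hence the diagonal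
  -- entries of E live on the eigenvalue θ. Neither idempotence of the E i nor distinctness of the θ
  -- i is needed.
  have key : ∀ i v, (hA.eigenvalues v - θ i) * (star U * E i * U) v v = 0 := by
    intro i v
    have h1 : D * (star U * E i * U) = θ i • (star U * E i * U) := by
      have h2 : D * star U = star U * A := by
        rw [hAD, ← mul_assoc, ← mul_assoc, hUU, one_mul]
      rw [← mul_assoc, ← mul_assoc, h2, mul_assoc (star U), hθ]
      simp
    have h3 := congrFun (congrFun h1 v) v
    rw [hD, diagonal_mul] at h3
    rw [sub_mul, h3]
    simp
  have hsum : ∀ v, ∑ i, (star U * E i * U) v v = 1 := by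
    intro v
    rw [← Matrix.sum_apply, ← Finset.sum_mul, ← Finset.mul_sum, hE, mul_one, hUU, one_apply_eq]
  have htr : ∀ i, ∑ v, (star U * E i * U) v v = m i := by
    intro i
    rw [← hm i]
    change (star U * E i * U).trace = _
    rw [trace_mul_comm, ← mul_assoc, hUU', one_mul]
  rw [hA.roots_charpoly_eq_eigenvalues]
  ext x
  have hc : ((Multiset.count x (Multiset.map (RCLike.ofReal ∘ hA.eigenvalues)
      (univ : Finset V).val) : ℕ) : ℝ) = ∑ v, if hA.eigenvalues v = x then (1 : ℝ) else 0 := by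
    rw [Multiset.count_map, Finset.sum_boole]
    simp only [Function.comp, eq_comm (a := x)]
    rfl
  rw [← Nat.cast_inj (R := ℝ), hc, Multiset.count_sum']
  push_cast
  calc ∑ v, (if hA.eigenvalues v = x then (1 : ℝ) else 0)
      = ∑ v, ∑ i, (if θ i = x then (star U * E i * U) v v else 0) := by
        refine sum_congr rfl fun v _ => ?_
        have : (if hA.eigenvalues v = x then (1 : ℝ) else 0) =
            ∑ i, if hA.eigenvalues v = x then (star U * E i * U) v v else 0 := by
          split_ifs
          · exact (hsum v).symm
          · simp
        rw [this]
        refine sum_congr rfl fun i _ => ?_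
        by_cases h : hA.eigenvalues v = θ i
        · rw [h]
        · have := (mul_eq_zero.1 (key i v)).resolve_left (sub_ne_zero.2 h)
          simp [this]
    _ = ∑ i, ((Multiset.count x (Multiset.replicate (m i) (θ i)) : ℕ) : ℝ) := by
        rw [sum_comm]
        refine sum_congr rfl fun i _ => ?_
        rw [Multiset.count_replicate]
        split_ifs
        · exact htr i
        · simp

end Eigenvalues

/-! ### Agreement matrices of nets -/

section Nets

variable {V C ι : Type*} [DecidableEq C]

/-- The all-ones matrix. -/
def allOnes (V : Type*) : Matrix V V ℝ := Matrix.of fun _ _ => 1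

@[simp]
theorem allOnes_apply (u v : V) : allOnes V u v = 1 := rfl

/-- The matrix counting, for two points, the maps of a family that agree at them. -/
noncomputable def agreement [Fintype ι] (f : ι → V → C) : Matrix V V ℝ :=
  Matrix.of fun u v => ∑ s, if f s u = f s v then 1 else 0

/-- A family of maps such that any two of them take each pair of values exactly `q` times. -/
def IsNet [Fintype V] (q : ℕ) (f : ι → V → C) : Prop :=
  ∀ s t, s ≠ t → ∀ c d, #{v | f s v = c ∧ f t v = d} = q

variable {q : ℕ} {f : ι → V → C}

theorem agreement_apply [Fintype ι] (f : ι → V → C) (u v : V) :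
    agreement f u v = #{s | f s u = f s v} := by
  rw [agreement, of_apply, sum_boole]

theorem agreement_self [Fintype ι] (f : ι → V → C) (u : V) :
    agreement f u u = Fintype.card ι := by
  simp [agreement]

theorem agreement_transpose [Fintype ι] (f : ι → V → C) : (agreement f)ᵀ = agreement f := by
  ext u v
  exact Finset.sum_congr rfl fun s _ => if_congr eq_comm rfl rfl

theorem trace_agreement [Fintype V] [Fintype ι] (f : ι → V → C) :
    (agreement f).trace = Fintype.card ι * Fintype.card V := by
  simp [agreement, Matrix.trace, mul_comm]

variable [Fintype V] [Fintype C]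

theorem IsNet.card_fiber [Nontrivial ι] (hf : IsNet q f) (s : ι) (c : C) :
    #{v | f s v = c} = q * Fintype.card C := by
  obtain ⟨t, ht⟩ := exists_ne s
  rw [card_eq_sum_card_fiberwise (f := f t) (t := univ) (fun _ _ => mem_coe.2 (mem_univ _))]
  simp only [filter_filter]
  rw [sum_congr rfl fun d _ => hf s t ht.symm c d]
  simp [mul_comm]

theorem IsNet.card_eq [Nontrivial ι] (hf : IsNet q f) :
    Fintype.card V = q * Fintype.card C ^ 2 := by
  obtain ⟨s⟩ := (inferInstance : Nonempty ι)
  rw [← card_univ, card_eq_sum_card_fiberwise (f := f s) (t := univ)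
    (fun _ _ => mem_coe.2 (mem_univ _)), sum_congr rfl fun c _ => hf.card_fiber s c]
  simp
  ring

/-- The sum counts the points common to the s-block of u and the t-block of v: q points if s ≠ t,
and a whole block or nothing if s = t. Splitting off the constant q lets the sum over all s, t be
read as a multiple of S plus a multiple of J. -/
theorem IsNet.sum_agree_mul_agree [DecidableEq ι] [Nontrivial ι] (hf : IsNet q f) (s t : ι) (u v : V) :
    ∑ w, ((if f s u = f s w then (1 : ℝ) else 0) * if f t w = f t v then 1 else 0) =
      (if s = t then (q : ℝ) * Fintype.card C * (if f s u = f s v then 1 else 0) - q else 0)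
        + q := by
  by_cases hst : s = t
  · subst hst
    by_cases huv : f s u = f s v
    · have := hf.card_fiber s (f s v)
      simp [huv, ← ite_and, eq_comm (a := f s v), this]
    · have : ∀ w, ¬ (f s w = f s v ∧ f s u = f s w) := fun w h => huv (h.2.trans h.1)
      simp only [ite_mul, one_mul, zero_mul, ← ite_and, and_comm (a := f s u = _), this]
      simp [huv]
  · have := hf s t hst (f s u) (f t v)
    simp [hst, ← ite_and, eq_comm (a := f s u), and_comm (b := _ = f s u)] at this ⊢
    simp [this]

theorem IsNet.agreement_mul_self [Fintype ι] [DecidableEq ι] [Nontrivial ι] (hf : IsNet q f) :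
    agreement f * agreement f = ((q : ℝ) * Fintype.card C) • agreement f +
      ((q : ℝ) * Fintype.card ι * (Fintype.card ι - 1)) • allOnes V := by
  ext u v
  simp only [mul_apply, agreement, of_apply, Matrix.add_apply, Matrix.smul_apply, smul_eq_mul,
    allOnes_apply, sum_mul_sum, mul_one]
  rw [sum_comm]
  simp_rw [sum_comm (s := (univ : Finset V)), hf.sum_agree_mul_agree, sum_add_distrib]
  simp only [sum_ite_eq, mem_univ, if_true, sum_sub_distrib, ← mul_sum, sum_const, card_univ,
    nsmul_eq_mul]
  ring

theorem IsNet.agreement_mul_allOnes [Fintype ι] [DecidableEq ι] [Nontrivial ι] (hf : IsNet q f) :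
    agreement f * allOnes V = ((q : ℝ) * Fintype.card C * Fintype.card ι) • allOnes V := by
  ext u v
  simp only [mul_apply, agreement, of_apply, Matrix.smul_apply, smul_eq_mul, allOnes_apply, mul_one]
  rw [sum_comm]
  have : ∀ s, ∑ w, (if f s u = f s w then (1 : ℝ) else 0) = q * Fintype.card C := by
    intro s
    have := hf.card_fiber s (f s u)
    simp [eq_comm (a := f s u), this]
  simp [this, mul_comm]

end Nets

section CommonNeighbours

variable {V : Type*} [Fintype V] (G : SimpleGraph V)

open Classical in
theorem adjMatrix_mul_self_apply (u v : V) :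
    (G.adjMatrix ℝ * G.adjMatrix ℝ) u v = (G.commonNeighbors u v).ncard := by
  rw [Set.ncard_eq_toFinset_card']
  simp only [mul_apply, SimpleGraph.adjMatrix_apply, ← ite_and, ite_mul, zero_mul, one_mul,
    sum_boole]
  congr 2
  ext w
  simp [SimpleGraph.mem_commonNeighbors, G.adj_comm w v]

end CommonNeighbours

/-! ### The matrix algebra shared by both graphs -/

section NetGraphs

open Classical in
/-- The adjacency matrix of `G` is `S + K - 1`, where `S` is the agreement matrix of a net with
`q + 1` classes of `q n` blocks of size `q² n`, and `K` is a correction term. -/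
structure IsNetGraph {V C : Type*} [Fintype V] [Fintype C] [DecidableEq C] (q n : ℕ) (G : SimpleGraph V)
    (f : Fin (q + 1) → V → C) (K : Matrix V V ℝ) : Prop where
  one_lt : 1 < q
  pos : 0 < n
  isNet : IsNet q f
  card_eq : Fintype.card C = q * n
  adjMatrix_add_one : G.adjMatrix ℝ + 1 = agreement f + K
  transpose_eq : Kᵀ = K
  agreement_mul : agreement f * K = -(q : ℝ) ^ 2 • agreement f
  mul_self : K * K = -(q : ℝ) ^ 2 • K
  trace_eq : K.trace = -(q : ℝ) * Fintype.card V

variable {V C : Type*} [Fintype V] [Fintype C] [DecidableEq C] {q n : ℕ} {G : SimpleGraph V}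
  {f : Fin (q + 1) → V → C} {K : Matrix V V ℝ}

theorem IsNetGraph.nontrivial (h : IsNetGraph q n G f K) : Nontrivial (Fin (q + 1)) :=
  Fin.nontrivial_iff_two_le.2 (by have := h.one_lt; omega)

theorem IsNetGraph.card_vertices (h : IsNetGraph q n G f K) :
    Fintype.card V = q ^ 3 * n ^ 2 := by
  have := h.nontrivial
  rw [h.isNet.card_eq, h.card_eq]
  ring

theorem IsNetGraph.mul_agreement (h : IsNetGraph q n G f K) :
    K * agreement f = -(q : ℝ) ^ 2 • agreement f := by
  have := congrArg Matrix.transpose h.agreement_mul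
  rwa [transpose_mul, transpose_smul, agreement_transpose, h.transpose_eq] at this

theorem IsNetGraph.agreement_mul_self (h : IsNetGraph q n G f K) :
    agreement f * agreement f = ((q : ℝ) ^ 2 * n) • agreement f +
      ((q : ℝ) ^ 2 * (q + 1)) • allOnes V := by
  have := h.nontrivial
  rw [h.isNet.agreement_mul_self, h.card_eq, Fintype.card_fin]
  push_cast
  congr 2 <;> ring

theorem IsNetGraph.agreement_mul_allOnes (h : IsNetGraph q n G f K) :
    agreement f * allOnes V = ((q : ℝ) ^ 2 * n * (q + 1)) • allOnes V := by
  have := h.nontrivial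
  rw [h.isNet.agreement_mul_allOnes, h.card_eq, Fintype.card_fin]
  push_cast
  congr 1
  ring

/-- J is a combination of S² and S, so K acts on J by the same scalar as on S. -/
theorem IsNetGraph.mul_allOnes (h : IsNetGraph q n G f K) :
    K * allOnes V = -(q : ℝ) ^ 2 • allOnes V := by
  have hq : (0 : ℝ) < q := by exact_mod_cast (by have := h.one_lt; omega : 0 < q)
  have hJ : allOnes V = ((q : ℝ) ^ 2 * (q + 1))⁻¹ •
      (agreement f * agreement f - ((q : ℝ) ^ 2 * n) • agreement f) := by
    rw [h.agreement_mul_self, add_sub_cancel_left, smul_smul, inv_mul_cancel₀ (by positivity),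
      one_smul]
  rw [hJ, mul_smul_comm, mul_sub, ← mul_assoc, mul_smul_comm, h.mul_agreement, smul_mul_assoc]
  module

-- Expand (S + K - 1)² with the relations, then eliminate K = A + 1 - S.
open Classical in
theorem IsNetGraph.adjMatrix_mul_self (h : IsNetGraph q n G f K) :
    G.adjMatrix ℝ * G.adjMatrix ℝ = ((q : ℝ) ^ 2 * (n - 1)) • agreement f +
      ((q : ℝ) ^ 2 * (q + 1)) • allOnes V - ((q : ℝ) ^ 2 + 2) • G.adjMatrix ℝ -
        ((q : ℝ) ^ 2 + 1) • (1 : Matrix V V ℝ) := by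
  have hA : G.adjMatrix ℝ = agreement f + K - 1 := by rw [← h.adjMatrix_add_one]; abel
  rw [hA]
  simp only [mul_sub, sub_mul, mul_add, add_mul, mul_one, one_mul, h.agreement_mul_self,
    h.mul_agreement, h.agreement_mul, h.mul_self]
  module

open Classical in
theorem IsNetGraph.ncard_commonNeighbors (h : IsNetGraph q n G f K) (u v : V) :
    ((G.commonNeighbors u v).ncard : ℝ) = (q : ℝ) ^ 2 * (n - 1) * agreement f u v +
      (q : ℝ) ^ 2 * (q + 1) - ((q : ℝ) ^ 2 + 2) * (if G.Adj u v then 1 else 0) -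
        ((q : ℝ) ^ 2 + 1) * (if u = v then 1 else 0) := by
  rw [← adjMatrix_mul_self_apply, h.adjMatrix_mul_self]
  simp [Matrix.one_apply]

theorem IsNetGraph.spectrum_eq (h : IsNetGraph q n G f K) :
    spectrum G =
      Multiset.replicate 1 ((q : ℝ) ^ 3 - 1 + (q : ℝ) ^ 2 * ((q : ℝ) + 1) * ((n : ℝ) - 1)) +
      Multiset.replicate ((q * n - 1) * (q + 1)) ((q : ℝ) ^ 2 * ((n : ℝ) - 1) - 1) +
      Multiset.replicate ((q - 1) * q ^ 2 * n ^ 2) (-1 : ℝ) +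
      Multiset.replicate ((q * n - 1) * (n - 1) * q) (-(q : ℝ) ^ 2 - 1) := by
  classical
  have hq : (0 : ℝ) < q := by exact_mod_cast (by have := h.one_lt; omega : 0 < q)
  have hn : (0 : ℝ) < n := by exact_mod_cast h.pos
  have hA : G.adjMatrix ℝ = agreement f + K - 1 := by rw [← h.adjMatrix_add_one]; abel
  have hH : (G.adjMatrix ℝ).IsHermitian := by
    rw [Matrix.IsHermitian, conjTranspose_eq_transpose_of_trivial, SimpleGraph.transpose_adjMatrix]
  have hcard : (Fintype.card V : ℝ) = q ^ 3 * n ^ 2 := by exact_mod_cast h.card_vertices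
  have htS : (agreement f).trace = (q + 1) * (q ^ 3 * n ^ 2 : ℝ) := by
    rw [trace_agreement, hcard]; simp
  have htK : K.trace = -(q : ℝ) * (q ^ 3 * n ^ 2) := by rw [h.trace_eq, hcard]
  have htJ : (allOnes V).trace = (q ^ 3 * n ^ 2 : ℝ) := by
    rw [← hcard]; simp [Matrix.trace]
  have ht1 : (1 : Matrix V V ℝ).trace = (q ^ 3 * n ^ 2 : ℝ) := by
    rw [← hcard, Matrix.trace_one]
  have hqn : ((q * n - 1 : ℕ) : ℝ) = q * n - 1 := by
    rw [Nat.cast_sub (Nat.mul_pos (by have := h.one_lt; omega) h.pos)]; simp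
  have hq1 : ((q - 1 : ℕ) : ℝ) = q - 1 := by
    rw [Nat.cast_sub h.one_lt.le]; simp
  have hn1 : ((n - 1 : ℕ) : ℝ) = n - 1 := by
    rw [Nat.cast_sub h.pos]; simp
  have hSS := h.agreement_mul_self
  have hSJ := h.agreement_mul_allOnes
  have hKS := h.mul_agreement
  have hSK := h.agreement_mul
  have hKJ := h.mul_allOnes
  have hKK := h.mul_self
  generalize agreement f = S at *
  generalize allOnes V = J at *
  -- These are the projections onto the constants, the rest of the image of S, the kernel of K, and
  -- what remains. On them (S, K) acts as (q²n(q+1), -q²), (q²n, -q²), (0, 0) and (0, -q²), which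
  -- gives the four eigenvalues of S + K - 1. For n = 1 the last multiplicity is 0.
  let E : Fin 4 → Matrix V V ℝ := ![
    ((q : ℝ) ^ 3 * n ^ 2)⁻¹ • J,
    ((q : ℝ) ^ 2 * n)⁻¹ • S - (((q : ℝ) ^ 3 * n ^ 2)⁻¹ * (q + 1)) • J,
    1 + ((q : ℝ) ^ 2)⁻¹ • K,
    (((q : ℝ) ^ 3 * n ^ 2)⁻¹ * q) • J - ((q : ℝ) ^ 2)⁻¹ • K - ((q : ℝ) ^ 2 * n)⁻¹ • S]
  have := roots_charpoly_of_sum_eq_one hH E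
    ![(q : ℝ) ^ 3 - 1 + (q : ℝ) ^ 2 * ((q : ℝ) + 1) * ((n : ℝ) - 1),
      (q : ℝ) ^ 2 * ((n : ℝ) - 1) - 1, -1, -(q : ℝ) ^ 2 - 1]
    ![1, (q * n - 1) * (q + 1), (q - 1) * q ^ 2 * n ^ 2, (q * n - 1) * (n - 1) * q] ?_ ?_ ?_
  · rw [spectrum, this]
    simp [Fin.sum_univ_four]
  · simp only [E, Fin.sum_univ_four, Matrix.cons_val]
    module
  · intro i
    rw [hA]
    fin_cases i <;>
    · simp only [E, Matrix.cons_val, Fin.zero_eta, Fin.mk_one, Fin.reduceFinMk, mul_sub, sub_mul, mul_add,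
        add_mul, mul_one, one_mul, mul_smul_comm, hSS, hSJ, hKS, hSK, hKJ, hKK]
      match_scalars <;> field_simp <;> ring
  · intro i
    fin_cases i <;>
    · simp [E, htS, htK, htJ, ht1, hqn, hq1, hn1]
      try field_simp
      try ring

end NetGraphs

end TwistedLatin

namespace TwistedLatin

open Finset Matrix

/-! ### Existence of planes and arrays -/

section Existence

variable {F : Type*} [Field F]

/-- The points of a conic in the dual projective plane, as linear functionals. -/
def conicFunctional : Option F → (Fin 3 → F) →ₗ[F] F
  | none => LinearMap.proj 2
  | some t => LinearMap.proj 0 + t • LinearMap.proj 1 + t ^ 2 • LinearMap.proj 2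

@[simp]
theorem conicFunctional_none (x : Fin 3 → F) : conicFunctional none x = x 2 := rfl

@[simp]
theorem conicFunctional_some (t : F) (x : Fin 3 → F) :
    conicFunctional (some t) x = x 0 + t * x 1 + t ^ 2 * x 2 := rfl

theorem conicFunctional_surjective (i : Option F) : Function.Surjective (conicFunctional i) := by
  intro a
  cases i with
  | none => exact ⟨![0, 0, a], by simp⟩
  | some t => exact ⟨![a, 0, 0], by simp⟩

/-- Three distinct points of a conic are not collinear: this is the Vandermonde argument by divided
differences, with `none` as the point at infinity. -/
theorem eq_zero_of_conicFunctional_eq_zero {h i j : Option F} (hhi : h ≠ i) (hhj : h ≠ j)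
    (hij : i ≠ j) {x : Fin 3 → F} (h1 : conicFunctional h x = 0) (h2 : conicFunctional i x = 0)
    (h3 : conicFunctional j x = 0) : x = 0 := by
  suffices x 0 = 0 ∧ x 1 = 0 ∧ x 2 = 0 by
    ext k
    fin_cases k
    exacts [this.1, this.2.1, this.2.2]
  have two : ∀ {t u : F}, t ≠ u → ∀ {a b : F}, a + t * b = 0 → a + u * b = 0 → a = 0 ∧ b = 0 := by
    intro t u htu a b h1 h2
    have hb : b = 0 :=
      (mul_eq_zero.1 (by linear_combination h1 - h2 : (t - u) * b = 0)).resolve_left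
        (sub_ne_zero.2 htu)
    subst hb
    exact ⟨by simpa using h1, rfl⟩
  have three : ∀ {t u v : F}, t ≠ u → t ≠ v → u ≠ v → x 0 + t * x 1 + t ^ 2 * x 2 = 0 →
      x 0 + u * x 1 + u ^ 2 * x 2 = 0 → x 0 + v * x 1 + v ^ 2 * x 2 = 0 →
      x 0 = 0 ∧ x 1 = 0 ∧ x 2 = 0 := by
    intro t u v htu htv huv h1 h2 h3
    have h4 : (x 1 + t * x 2) + u * x 2 = 0 :=
      (mul_eq_zero.1 (by linear_combination h1 - h2 :
        (t - u) * ((x 1 + t * x 2) + u * x 2) = 0)).resolve_left (sub_ne_zero.2 htu)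
    have h5 : (x 1 + t * x 2) + v * x 2 = 0 :=
      (mul_eq_zero.1 (by linear_combination h1 - h3 :
        (t - v) * ((x 1 + t * x 2) + v * x 2) = 0)).resolve_left (sub_ne_zero.2 htv)
    obtain ⟨h6, h7⟩ := two huv h4 h5
    have h8 : x 1 = 0 := by simpa [h7] using h6
    exact ⟨by simpa [h7, h8] using h1, h8, h7⟩
  rcases h with _ | t <;> rcases i with _ | u <;> rcases j with _ | v <;>
    simp only [conicFunctional_none, conicFunctional_some, ne_eq, not_true_eq_false,
      Option.some.injEq] at *
  · rw [h1] at h2 h3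
    simp only [mul_zero, add_zero] at h2 h3
    exact ⟨(two hij h2 h3).1, (two hij h2 h3).2, h1⟩
  · rw [h2] at h1 h3
    simp only [mul_zero, add_zero] at h1 h3
    exact ⟨(two hhj h1 h3).1, (two hhj h1 h3).2, h2⟩
  · rw [h3] at h1 h2
    simp only [mul_zero, add_zero] at h1 h2
    exact ⟨(two hhi h1 h2).1, (two hhi h1 h2).2, h3⟩
  · exact three hhi hhj hij h1 h2 h3

theorem existsUnique_conicFunctional_eq {h i j : Option F} (hhi : h ≠ i) (hhj : h ≠ j)
    (hij : i ≠ j) (a b c : F) :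
    ∃! x, conicFunctional h x = a ∧ conicFunctional i x = b ∧ conicFunctional j x = c := by
  let ψ : (Fin 3 → F) →ₗ[F] (Fin 3 → F) :=
    LinearMap.pi ![conicFunctional h, conicFunctional i, conicFunctional j]
  have hψ : ∀ x, ψ x = ![conicFunctional h x, conicFunctional i x, conicFunctional j x] := by
    intro x
    ext k
    fin_cases k <;> rfl
  have inj : Function.Injective ψ := by
    rw [← LinearMap.ker_eq_bot, LinearMap.ker_eq_bot']
    intro x hx
    rw [hψ] at hx
    exact eq_zero_of_conicFunctional_eq_zero hhi hhj hij (congrFun hx 0) (congrFun hx 1)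
      (congrFun hx 2)
  have bij : Function.Bijective ψ := ⟨inj, LinearMap.injective_iff_surjective.1 inj⟩
  refine (existsUnique_congr fun x => ?_).1 (bij.existsUnique ![a, b, c])
  rw [hψ]
  simp

/-- The plane on which a point of the dual conic takes a given value. -/
noncomputable def conicPlane (i : Option F) (a : F) : AffineSubspace F (Fin 3 → F) :=
  AffineSubspace.mk' (Function.surjInv (conicFunctional_surjective i) a)
    (LinearMap.ker (conicFunctional i))

@[simp]
theorem mem_conicPlane {i : Option F} {a : F} {x : Fin 3 → F} :
    x ∈ conicPlane i a ↔ conicFunctional i x = a := by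
  rw [conicPlane, AffineSubspace.mem_mk', LinearMap.mem_ker, vsub_eq_sub, map_sub,
    Function.surjInv_eq (conicFunctional_surjective i), sub_eq_zero]

theorem isPlane_conicPlane (i : Option F) (a : F) : IsPlane (conicPlane i a) := by
  refine ⟨AffineSubspace.mk'_nonempty _ _, ?_⟩
  rw [conicPlane, AffineSubspace.direction_mk']
  have := LinearMap.finrank_range_add_finrank_ker (conicFunctional i)
  rw [LinearMap.range_eq_top.2 (conicFunctional_surjective i), finrank_top] at this
  simp at this
  omega

theorem exists_isPlaneSystem [Fintype F] {q : ℕ} (hF : Fintype.card F = q) :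
    ∃ P : Fin (q + 1) → Fin q → AffineSubspace F (Fin 3 → F), IsPlaneSystem q P := by
  classical
  let e : Fin (q + 1) ≃ Option F := Fintype.equivOfCardEq (by simp [hF])
  let g : Fin q ≃ F := Fintype.equivOfCardEq (by simp [hF])
  have hq : 2 ≤ q := hF ▸ Fintype.one_lt_card
  refine ⟨fun i a => conicPlane (e i) (g a), fun i a => isPlane_conicPlane _ _, ?_, ?_, ?_⟩
  · intro i a b hab
    rw [Set.disjoint_left]
    intro x hx hy
    rw [SetLike.mem_coe, mem_conicPlane] at hx hy
    exact hab (g.injective (hx.symm.trans hy))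
  · intro i j hij a b
    -- Since q + 1 ≥ 3 there is a third class. Its functional is a coordinate on the intersection of
    -- the two planes, which therefore has q points.
    obtain ⟨k, hki, hkj⟩ : ∃ k, k ≠ i ∧ k ≠ j := by
      obtain ⟨k, hk⟩ := Finset.exists_mem_notMem_of_card_lt_card (s := {i, j}) (t := univ)
        (lt_of_le_of_lt Finset.card_le_two (by simp; omega))
      exact ⟨k, by simpa using hk⟩
    have key := fun c => existsUnique_conicFunctional_eq (e.injective.ne hij)
      (e.injective.ne hki.symm) (e.injective.ne hkj.symm) (g a) (g b) c
    have hcard : (Set.univ : Set F).ncard = q := by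
      rw [Set.ncard_univ, Nat.card_eq_fintype_card, hF]
    rw [← Set.InjOn.ncard_image (f := conicFunctional (e k))]
    · refine Eq.trans ?_ hcard
      congr 1
      refine Set.eq_univ_of_forall fun c => ?_
      obtain ⟨x, ⟨h1, h2, h3⟩, -⟩ := key c
      exact ⟨x, ⟨by simpa using h1, by simpa using h2⟩, h3⟩
    · rintro x ⟨hx1, hx2⟩ y ⟨hy1, hy2⟩ hxy
      rw [SetLike.mem_coe, mem_conicPlane] at hx1 hx2 hy1 hy2
      exact (key (conicFunctional (e k) y)).unique ⟨hx1, hx2, hxy⟩ ⟨hy1, hy2, rfl⟩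
  · intro h i j hhi hij a b c
    obtain ⟨x, hx, hx'⟩ := existsUnique_conicFunctional_eq (e.injective.ne hhi.ne)
      (e.injective.ne (hhi.trans hij).ne) (e.injective.ne hij.ne) (g a) (g b) (g c)
    rw [Set.ncard_eq_one]
    refine ⟨x, Set.ext fun y => ?_⟩
    simp only [Set.mem_inter_iff, SetLike.mem_coe, mem_conicPlane, Set.mem_singleton_iff, and_assoc]
    exact ⟨hx' y, fun hy => hy ▸ hx⟩

/-- The parallel classes of lines of an affine plane whose points are pairs of vectors. -/
def lineClass {M : Type*} [AddCommGroup M] [Module F M] : Option F → M × M → M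
  | none => fun p => p.2
  | some t => fun p => p.1 + t • p.2

theorem lineClass_prod_injective {M : Type*} [AddCommGroup M] [Module F M] {i j : Option F}
    (hij : i ≠ j) : Function.Injective fun p : M × M => (lineClass i p, lineClass j p) := by
  rintro ⟨x, y⟩ ⟨x', y'⟩ h
  rcases i with _ | t <;> rcases j with _ | u
  · exact absurd rfl hij
  · simp only [lineClass, Prod.mk.injEq] at h
    obtain ⟨rfl, h⟩ := h
    rw [add_right_cancel h]
  · simp only [lineClass, Prod.mk.injEq] at h
    obtain ⟨h, rfl⟩ := h
    rw [add_right_cancel h]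
  · simp only [lineClass, Prod.mk.injEq] at h
    obtain ⟨h1, h2⟩ := h
    have htu : t - u ≠ 0 := sub_ne_zero.2 fun h => hij (congrArg some h)
    have h3 : (t - u) • y = (t - u) • y' := by
      have := congrArg₂ (· - ·) h1 h2
      simpa [sub_smul] using this
    have h4 : y = y' := smul_right_injective M htu h3
    subst h4
    rw [add_right_cancel h1]

/-- Rows of one group may coincide, so it suffices to repeat s times each row of an ordinary array,
given by q + 1 parallel classes on F^k × F^k. -/
theorem exists_isGroupDivisibleOA [Fintype F] {q : ℕ} (hF : Fintype.card F = q) (s k : ℕ) :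
    ∃ O : Fin (q + 1) → Fin s → Fin ((q ^ k) ^ 2) → Fin (q ^ k),
      IsGroupDivisibleOA (q ^ k) s (q + 1) O := by
  classical
  let e : Fin (q + 1) ≃ Option F := Fintype.equivOfCardEq (by simp [hF])
  let g : (Fin k → F) ≃ Fin (q ^ k) := Fintype.equivOfCardEq (by simp [hF])
  let p : Fin ((q ^ k) ^ 2) ≃ (Fin k → F) × (Fin k → F) :=
    Fintype.equivOfCardEq (by simp [hF, sq])
  refine ⟨fun i _ l => g (lineClass (e i) (p l)), fun i j hij a b => ?_⟩
  rw [Finset.card_image_of_injective, card_univ, Fintype.card_fin]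
  intro l l' h
  rw [Prod.mk.injEq] at h
  exact p.injective (lineClass_prod_injective (e.injective.ne hij)
    (Prod.ext (g.injective h.1) (g.injective h.2)))

end Existence

end TwistedLatin

namespace TwistedLatin

open Finset Matrix
open scoped Kronecker

/-! ### Regularity and level of net graphs -/

section NetGraphs

variable {V C : Type*} [Fintype V] [Fintype C] [DecidableEq C] {q n : ℕ} {G : SimpleGraph V}
  {f : Fin (q + 1) → V → C} {K : Matrix V V ℝ}

theorem IsNetGraph.isCoEdgeRegular (h : IsNetGraph q n G f K)
    (hG : ∀ u v, u ≠ v → ¬ G.Adj u v → agreement f u v = 0) :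
    IsCoEdgeRegular G ((q + 1) * q ^ 2) := by
  classical
  refine ⟨⟨q ^ 2 * (n - 1) * (q + 1) + q ^ 3 - 1, ?_⟩, ?_⟩
  · intro u
    -- The common neighbours of u with itself are its neighbours, so the diagonal case gives the
    -- degree.
    have h1 := h.ncard_commonNeighbors u u
    rw [SimpleGraph.commonNeighbors_eq, Set.inter_self, Set.ncard_eq_toFinset_card',
      agreement_self, Fintype.card_fin] at h1
    simp only [SimpleGraph.irrefl, if_false, if_true, mul_zero, mul_one, sub_zero] at h1
    rw [← Nat.cast_inj (R := ℝ), Nat.cast_sub]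
    · rw [← SimpleGraph.card_neighborFinset_eq_degree]
      push_cast [Nat.cast_sub (show 1 ≤ n from h.pos)]
      refine Eq.trans ?_ (h1.trans (by push_cast; ring))
      congr!
    · have := Nat.pow_pos (n := 3) (zero_lt_one.trans h.one_lt)
      omega
  · intro u v huv hadj
    have h1 := h.ncard_commonNeighbors u v
    rw [hG u v huv hadj, if_neg hadj, if_neg huv] at h1
    rw [← Nat.cast_inj (R := ℝ), h1]
    push_cast
    ring

theorem IsNetGraph.level_eq_three (h : IsNetGraph q n G f K) (hn : 2 ≤ n)
    (hle : ∀ u v, G.Adj u v → agreement f u v = 0 ∨ agreement f u v = 1 ∨ agreement f u v = 2)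
    (h0 : ∃ u v, G.Adj u v ∧ agreement f u v = 0) (h1 : ∃ u v, G.Adj u v ∧ agreement f u v = 1)
    (h2 : ∃ u v, G.Adj u v ∧ agreement f u v = 2) : level G = 3 := by
  have hq := h.one_lt
  have hq3 : 2 ≤ q ^ 3 := le_trans hq (Nat.le_self_pow (by norm_num) q)
  have key : ∀ (u v : V) (k : ℕ), G.Adj u v → agreement f u v = k →
      (G.commonNeighbors u v).ncard = q ^ 2 * (n - 1) * k + (q ^ 3 - 2) := by
    intro u v k hadj hk
    have := h.ncard_commonNeighbors u v
    rw [hk, if_pos hadj, if_neg hadj.ne] at this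
    rw [← Nat.cast_inj (R := ℝ), this]
    push_cast [Nat.cast_sub (show 1 ≤ n from h.pos), Nat.cast_sub hq3]
    ring
  -- The slope q²(n - 1) is positive because n ≥ 2; distinct agreement numbers thus give distinct
  -- values of λ.
  have inj : Function.Injective fun k => q ^ 2 * (n - 1) * k + (q ^ 3 - 2) := by
    intro k l hkl
    have : 0 < q ^ 2 * (n - 1) := Nat.mul_pos (by positivity) (by omega)
    exact Nat.eq_of_mul_eq_mul_left this (Nat.add_right_cancel hkl)
  have hset : {l : ℕ | ∃ x y : V, G.Adj x y ∧ (G.commonNeighbors x y).ncard = l} =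
      (fun k => q ^ 2 * (n - 1) * k + (q ^ 3 - 2)) '' ({0, 1, 2} : Finset ℕ) := by
    ext l
    constructor
    · rintro ⟨u, v, hadj, rfl⟩
      rcases hle u v hadj with hk | hk | hk
      · exact ⟨0, by simp, (key u v 0 hadj (by simpa using hk)).symm⟩
      · exact ⟨1, by simp, (key u v 1 hadj (by simpa using hk)).symm⟩
      · exact ⟨2, by simp, (key u v 2 hadj (by simpa using hk)).symm⟩
    · rintro ⟨k, hk, rfl⟩
      have : k = 0 ∨ k = 1 ∨ k = 2 := by simpa using hk
      obtain ⟨u, v, hadj, hk⟩ : ∃ u v, G.Adj u v ∧ agreement f u v = k := by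
        rcases this with rfl | rfl | rfl
        exacts [by simpa using h0, by simpa using h1, by simpa using h2]
      exact ⟨u, v, hadj, key u v k hadj hk⟩
  rw [level, hset, Set.ncard_image_of_injective _ inj, Set.ncard_coe_finset]
  rfl

end NetGraphs

/-! ### Clique extensions of Latin square graphs -/

section CliqueExtension

variable {q n : ℕ}

/-- If `m²` columns show `m²` different pairs of entries, then every pair of entries occurs exactly
once. -/
theorem bijective_of_card_image_eq {m : ℕ} {g : Fin (m ^ 2) → Fin m × Fin m}
    (h : (univ.image g).card = m ^ 2) : Function.Bijective g := by
  have inj : Function.Injective g := by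
    rw [← Set.injOn_univ, ← coe_univ, ← card_image_iff, h, card_univ, Fintype.card_fin]
  exact (Fintype.bijective_iff_injective_and_card g).2 ⟨inj, by simp [sq]⟩

theorem IsOrthogonalArray.bijective {m t : ℕ} {A : Fin t → Fin (m ^ 2) → Fin m}
    (hA : IsOrthogonalArray m t A) {i j : Fin t} (hij : i ≠ j) :
    Function.Bijective fun l => (A i l, A j l) := by
  rcases lt_or_gt_of_ne hij with h | h
  · exact bijective_of_card_image_eq (hA i j h)
  · exact Prod.swap_bijective.comp (bijective_of_card_image_eq (hA j i h))

/-- Two copies of one column agree in all q + 1 rows, and -q brings this down to 1. Distinct columns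
agree in at most one row, so S is already right there. -/
theorem isNetGraph_cliqueExtension (hq : 1 < q) (hn : 0 < n)
    {A : Fin (q + 1) → Fin ((q * n) ^ 2) → Fin (q * n)}
    (hA : IsOrthogonalArray (q * n) (q + 1) A) :
    IsNetGraph q n (cliqueExtension q (latinSquareGraph A)) (fun s u => A s u.1)
      ((1 : Matrix (Fin ((q * n) ^ 2)) (Fin ((q * n) ^ 2)) ℝ) ⊗ₖ
        (-(q : ℝ) • allOnes (Fin q))) where
  one_lt := hq
  pos := hn
  isNet := by
    classical
    intro s t hst c d
    obtain ⟨l, hl, hl'⟩ := (hA.bijective hst).existsUnique (c, d)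
    have : ({v | A s v.1 = c ∧ A t v.1 = d} : Finset (Fin ((q * n) ^ 2) × Fin q)) =
        {l} ×ˢ univ := by
      ext ⟨l', a⟩
      simp only [mem_filter, mem_univ, true_and, mem_product, mem_singleton, and_true]
      constructor
      · rintro ⟨h1, h2⟩
        exact hl' l' (Prod.ext h1 h2)
      · rintro rfl
        exact ⟨congrArg Prod.fst hl, congrArg Prod.snd hl⟩
    exact (congrArg card this).trans (by simp)
  card_eq := by simp
  adjMatrix_add_one := by
    classical
    ext ⟨l, a⟩ ⟨l', b⟩
    simp only [Matrix.add_apply, SimpleGraph.adjMatrix_apply, kroneckerMap_apply,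
      Matrix.smul_apply, allOnes_apply, smul_eq_mul, mul_one, Matrix.one_apply, agreement_apply]
    by_cases hl : l = l'
    · subst hl
      by_cases hab : a = b
      · simp [hab, cliqueExtension]
      · simp [hab, cliqueExtension]
    · have hcard : #{s | A s l = A s l'} = if ∃ s, A s l = A s l' then 1 else 0 := by
        split_ifs with h
        · obtain ⟨s, hs⟩ := h
          refine card_eq_one.2 ⟨s, ext fun t => ?_⟩
          simp only [mem_filter, mem_univ, true_and, mem_singleton]
          refine ⟨fun ht => ?_, fun ht => ht ▸ hs⟩
          by_contra hts
          exact hl ((hA.bijective hts).injective (Prod.ext ht hs))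
        · simpa [filter_eq_empty_iff] using h
      rw [hcard]
      simp [hl, cliqueExtension, latinSquareGraph]
  transpose_eq := by
    ext ⟨l, a⟩ ⟨l', b⟩
    simp [Matrix.one_apply, eq_comm]
  agreement_mul := by
    classical
    ext ⟨l, a⟩ ⟨l', b⟩
    simp only [mul_apply, Fintype.sum_prod_type, agreement, of_apply, kroneckerMap_apply,
      Matrix.one_apply, Matrix.smul_apply, allOnes_apply]
    simp
    ring
  mul_self := by
    rw [← mul_kronecker_mul, one_mul, ← kronecker_smul]
    congr 1
    ext a b
    simp [mul_apply]
    ring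
  trace_eq := by
    rw [trace_kronecker]
    simp [Matrix.trace]
    ring

end CliqueExtension

/-! ### Twisted Latin square graphs -/

section TwistedLatinSquareGraphs

variable {F : Type*} [Field F] {q n : ℕ}

/-- The planes of each class cover the space: for two classes s and t, the q² intersections are
disjoint sets of q points, hence exhaust all q³ points. Each class is then the fibration of a map to
`Fin q`. -/
theorem IsPlaneSystem.exists_isNet [Fintype F] (hF : Fintype.card F = q)
    {P : Fin (q + 1) → Fin q → AffineSubspace F (Fin 3 → F)} (hP : IsPlaneSystem q P) :
    ∃ c : Fin (q + 1) → (Fin 3 → F) → Fin q, (∀ s a x, x ∈ P s a ↔ c s x = a) ∧ IsNet q c := by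
  classical
  have hq : 1 < q := hF ▸ Fintype.one_lt_card
  have : Nontrivial (Fin (q + 1)) := Fin.nontrivial_iff_two_le.2 (by omega)
  have hcover : ∀ s x, ∃ a, x ∈ P s a := by
    intro s x
    obtain ⟨t, hts⟩ := exists_ne s
    have hunion : (univ : Finset (Fin q × Fin q)).biUnion
        (fun p => {x | x ∈ P s p.1 ∧ x ∈ P t p.2}) = univ := by
      rw [← card_eq_iff_eq_univ, card_biUnion]
      · have : ∀ p : Fin q × Fin q, #{x | x ∈ P s p.1 ∧ x ∈ P t p.2} = q := by
          intro p
          refine Eq.trans ?_ (hP.card_inter_two s t hts.symm p.1 p.2)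
          rw [Set.ncard_eq_toFinset_card']
          congr 1
          ext x
          simp
        simp [this, hF]
        ring
      · rintro ⟨a, b⟩ - ⟨a', b'⟩ - hab
        rw [Function.onFun, Finset.disjoint_left]
        simp only [mem_filter, mem_univ, true_and, not_and]
        intro x ⟨hx1, hx2⟩ hx1' hx2'
        refine hab (Prod.ext ?_ ?_)
        · by_contra h
          exact Set.disjoint_left.1 (hP.parallel s a a' h) hx1 hx1'
        · by_contra h
          exact Set.disjoint_left.1 (hP.parallel t b b' h) hx2 hx2'
    have hx : x ∈ (univ : Finset (Fin q × Fin q)).biUnion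
        (fun p => {x | x ∈ P s p.1 ∧ x ∈ P t p.2}) := by
      rw [hunion]
      exact mem_univ x
    simp only [mem_biUnion, mem_filter, mem_univ, true_and] at hx
    obtain ⟨p, hp, -⟩ := hx
    exact ⟨p.1, hp⟩
  choose c hc using hcover
  have hmem : ∀ s a x, x ∈ P s a ↔ c s x = a := by
    intro s a x
    refine ⟨fun hx => ?_, fun hx => hx ▸ hc s x⟩
    by_contra h
    exact Set.disjoint_left.1 (hP.parallel s _ _ h) (hc s x) hx
  refine ⟨c, hmem, fun s t hst a b => ?_⟩
  refine Eq.trans ?_ (hP.card_inter_two s t hst a b)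
  rw [Set.ncard_eq_toFinset_card']
  congr 1
  ext x
  simp [hmem]

theorem IsPlaneSystem.eq_of_mem {P : Fin (q + 1) → Fin q → AffineSubspace F (Fin 3 → F)}
    (hP : IsPlaneSystem q P) {h i j : Fin (q + 1)} (hhi : h ≠ i) (hhj : h ≠ j) (hij : i ≠ j)
    {a b c : Fin q} {x y : Fin 3 → F} (hx : x ∈ P h a ∧ x ∈ P i b ∧ x ∈ P j c)
    (hy : y ∈ P h a ∧ y ∈ P i b ∧ y ∈ P j c) : x = y := by
  have ordered : ∀ {h i j : Fin (q + 1)} {a b c : Fin q}, h < i → i < j →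
      (x ∈ P h a ∧ x ∈ P i b ∧ x ∈ P j c) → (y ∈ P h a ∧ y ∈ P i b ∧ y ∈ P j c) → x = y := by
    intro h i j a b c hhi hij hx hy
    obtain ⟨z, hz⟩ := Set.ncard_eq_one.1 (hP.card_inter_three h i j hhi hij a b c)
    have hx' : x ∈ ({z} : Set (Fin 3 → F)) := hz ▸ ⟨⟨hx.1, hx.2.1⟩, hx.2.2⟩
    have hy' : y ∈ ({z} : Set (Fin 3 → F)) := hz ▸ ⟨⟨hy.1, hy.2.1⟩, hy.2.2⟩
    exact hx'.trans hy'.symm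
  obtain ⟨hx1, hx2, hx3⟩ := hx
  obtain ⟨hy1, hy2, hy3⟩ := hy
  rcases lt_or_gt_of_ne hhi with h1 | h1 <;> rcases lt_or_gt_of_ne hhj with h2 | h2 <;>
    rcases lt_or_gt_of_ne hij with h3 | h3
  · exact ordered h1 h3 ⟨hx1, hx2, hx3⟩ ⟨hy1, hy2, hy3⟩
  · exact ordered h2 h3 ⟨hx1, hx3, hx2⟩ ⟨hy1, hy3, hy2⟩
  · exact absurd (h1.trans h3) h2.not_gt
  · exact ordered h2 h1 ⟨hx3, hx1, hx2⟩ ⟨hy3, hy1, hy2⟩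
  · exact ordered h1 h2 ⟨hx2, hx1, hx3⟩ ⟨hy2, hy1, hy3⟩
  · exact absurd (h3.trans h1) h2.not_gt
  · exact ordered h3 h2 ⟨hx2, hx3, hx1⟩ ⟨hy2, hy3, hy1⟩
  · exact ordered h3 h1 ⟨hx3, hx2, hx1⟩ ⟨hy3, hy2, hy1⟩

theorem IsGroupDivisibleOA.bijective {s t : ℕ} {O : Fin t → Fin s → Fin (n ^ 2) → Fin n}
    (hO : IsGroupDivisibleOA n s t O) {i j : Fin t} (hij : i ≠ j) (a b : Fin s) :
    Function.Bijective fun l => (O i a l, O j b l) :=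
  bijective_of_card_image_eq (hO i j hij a b)

section Net

variable {X : Type*} [Fintype X] {c : Fin (q + 1) → X → Fin q}

/-- Summing the correction term over a block of a net on `q³` points. -/
theorem IsNet.sum_agree_mul_one_sub_agreement (hq : 1 < q) (hc : IsNet q c) (s : Fin (q + 1))
    (x y : X) : ∑ z, (if c s x = c s z then (1 : ℝ) else 0) * (1 - agreement c z y) =
      -(q : ℝ) ^ 2 * if c s x = c s y then 1 else 0 := by
  have : Nontrivial (Fin (q + 1)) := Fin.nontrivial_iff_two_le.2 (by omega)
  have hfib : ∑ z, (if c s x = c s z then (1 : ℝ) else 0) = q * q := by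
    have := hc.card_fiber s (c s x)
    simp only [Fintype.card_fin] at this
    rw [sum_boole]
    simp only [eq_comm (a := c s x), this]
    push_cast
    ring
  simp only [mul_sub, mul_one, sum_sub_distrib, hfib]
  have : ∑ z, (if c s x = c s z then (1 : ℝ) else 0) * agreement c z y =
      ∑ t, ∑ z, (if c s x = c s z then (1 : ℝ) else 0) * if c t z = c t y then 1 else 0 := by
    rw [sum_comm]
    refine sum_congr rfl fun z _ => ?_
    rw [agreement, of_apply, mul_sum]
  -- The q classes t ≠ s contribute q each, cancelling the q² points of the block; only the term t =
  -- s survives.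
  rw [this, sum_congr rfl fun t _ => hc.sum_agree_mul_agree s t x y, sum_add_distrib, sum_ite_eq,
    if_pos (mem_univ _), sum_const, card_univ, Fintype.card_fin, Fintype.card_fin, nsmul_eq_mul]
  push_cast
  ring

theorem IsNet.one_sub_agreement_mul_self (hq : 1 < q) (hc : IsNet q c) :
    (allOnes X - agreement c) * (allOnes X - agreement c) =
      -(q : ℝ) ^ 2 • (allOnes X - agreement c) := by
  have : Nontrivial (Fin (q + 1)) := Fin.nontrivial_iff_two_le.2 (by omega)
  have hSJ := hc.agreement_mul_allOnes
  have hJS := congrArg Matrix.transpose hSJ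
  have hJt : (allOnes X)ᵀ = allOnes X := rfl
  rw [transpose_mul, transpose_smul, agreement_transpose, hJt] at hJS
  have hJJ : allOnes X * allOnes X = ((q : ℝ) ^ 3) • allOnes X := by
    ext x y
    have := hc.card_eq
    rw [Fintype.card_fin] at this
    simp [mul_apply, this]
    ring
  rw [sub_mul, mul_sub, mul_sub, hJJ, hJS, hSJ, hc.agreement_mul_self]
  simp only [Fintype.card_fin]
  push_cast
  module

/-- A second moment argument. If the agreement k were always 1 or 2 off x, the sum of (k - 1)(k - 2)
would reduce to its term q(q - 1) at x, whereas the first two moments give q²(q - 1). -/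
theorem IsNet.exists_agreement_eq_zero (hq : 1 < q) (hc : IsNet q c)
    (hle : ∀ x y, x ≠ y → agreement c x y = 0 ∨ agreement c x y = 1 ∨ agreement c x y = 2)
    (x : X) : ∃ y, x ≠ y ∧ agreement c x y = 0 := by
  classical
  have : Nontrivial (Fin (q + 1)) := Fin.nontrivial_iff_two_le.2 (by omega)
  by_contra! hne
  have h1 : ∑ y, agreement c x y = (q : ℝ) ^ 2 * (q + 1) := by
    have := congrFun (congrFun hc.agreement_mul_allOnes x) x
    simp only [mul_apply, allOnes_apply, mul_one, Matrix.smul_apply, smul_eq_mul,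
      Fintype.card_fin] at this
    rw [this]
    push_cast
    ring
  have h2 : ∑ y, agreement c x y ^ 2 = 2 * ((q : ℝ) ^ 2 * (q + 1)) := by
    have := congrFun (congrFun hc.agreement_mul_self x) x
    have hsymm : ∀ y, agreement c y x = agreement c x y := fun y =>
      congrFun (congrFun (agreement_transpose c) x) y
    simp only [mul_apply, Matrix.add_apply, allOnes_apply, mul_one, Matrix.smul_apply, smul_eq_mul,
      Fintype.card_fin, agreement_self, hsymm, ← sq] at this
    rw [this]
    push_cast
    ring
  have h3 : ∑ _y : X, (2 : ℝ) = 2 * q ^ 3 := by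
    have := hc.card_eq
    rw [Fintype.card_fin] at this
    rw [sum_const, card_univ, this, nsmul_eq_mul]
    push_cast
    ring
  have h4 : ∑ y, (agreement c x y - 1) * (agreement c x y - 2) = (q : ℝ) * (q - 1) := by
    rw [sum_eq_single x]
    · rw [agreement_self, Fintype.card_fin]
      push_cast
      ring
    · intro y _ hyx
      rcases hle x y hyx.symm with h | h | h
      · exact absurd h (hne y hyx.symm)
      · simp [h]
      · simp [h]
    · simp
  have h5 : ∑ y, (agreement c x y - 1) * (agreement c x y - 2) =
      ∑ y, agreement c x y ^ 2 - 3 * ∑ y, agreement c x y + ∑ _y : X, (2 : ℝ) := by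
    rw [mul_sum, ← sum_sub_distrib, ← sum_add_distrib]
    exact sum_congr rfl fun y _ => by ring
  rw [h4, h1, h2, h3] at h5
  have hq' : (1 : ℝ) < q := by exact_mod_cast hq
  have : (q : ℝ) * (q - 1) ^ 2 = 0 := by linear_combination -h5
  have : (0 : ℝ) < q * (q - 1) ^ 2 := mul_pos (by linarith) (pow_pos (by linarith) 2)
  linarith

end Net

/-- The block of the class `s` of a vertex of the twisted Latin square graph. -/
def twistedBlock {X : Type*} (c : Fin (q + 1) → X → Fin q)
    (O : Fin (q + 1) → Fin q → Fin (n ^ 2) → Fin n) (s : Fin (q + 1)) (u : X × Fin (n ^ 2)) :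
    Fin q × Fin n :=
  (c s u.1, O s (c s u.1) u.2)

variable {P : Fin (q + 1) → Fin q → AffineSubspace F (Fin 3 → F)}
  {O : Fin (q + 1) → Fin q → Fin (n ^ 2) → Fin n} {c : Fin (q + 1) → (Fin 3 → F) → Fin q}

theorem twistedLatinSquareGraph_adj (hcP : ∀ s a x, x ∈ P s a ↔ c s x = a)
    {u v : (Fin 3 → F) × Fin (n ^ 2)} : (twistedLatinSquareGraph P O).Adj u v ↔
      u ≠ v ∧ (u.2 = v.2 ∨ ∃ s, twistedBlock c O s u = twistedBlock c O s v) := by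
  simp only [twistedLatinSquareGraph, twistedBlock, hcP, Prod.mk.injEq]
  refine and_congr_right fun _ => or_congr_right (exists_congr fun s => ?_)
  constructor
  · rintro ⟨a, hu, hv, h⟩
    rw [hu, hv]
    exact ⟨rfl, h⟩
  · rintro ⟨h1, h2⟩
    exact ⟨c s v.1, h1, rfl, h1 ▸ h2⟩

/-- Rows of different groups jointly separate columns, whichever planes select them. -/
theorem twistedBlock_injective_snd {X : Type*} {c : Fin (q + 1) → X → Fin q}
    (hO : IsGroupDivisibleOA n q (q + 1) O) {s t : Fin (q + 1)}
    (hst : s ≠ t) {u v : X × Fin (n ^ 2)} (hs : twistedBlock c O s u = twistedBlock c O s v)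
    (ht : twistedBlock c O t u = twistedBlock c O t v) : u.2 = v.2 := by
  simp only [twistedBlock, Prod.mk.injEq] at hs ht
  refine (hO.bijective hst (c s v.1) (c t v.1)).injective (Prod.ext ?_ ?_)
  · rw [← hs.2, hs.1]
  · rw [← ht.2, ht.1]

theorem agreement_twistedBlock_of_snd_ne {X : Type*} {c : Fin (q + 1) → X → Fin q}
    (hO : IsGroupDivisibleOA n q (q + 1) O) {u v : X × Fin (n ^ 2)} (huv : u.2 ≠ v.2) :
    agreement (twistedBlock c O) u v =
      if ∃ s, twistedBlock c O s u = twistedBlock c O s v then 1 else 0 := by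
  rw [agreement_apply]
  split_ifs with h
  · obtain ⟨s, hs⟩ := h
    rw [Nat.cast_eq_one, card_eq_one]
    refine ⟨s, ext fun t => ?_⟩
    simp only [mem_filter, mem_univ, true_and, mem_singleton]
    refine ⟨fun ht => ?_, fun ht => ht ▸ hs⟩
    by_contra hts
    exact huv (twistedBlock_injective_snd hO hts ht hs)
  · push Not at h
    simpa [filter_eq_empty_iff] using h

theorem agreement_twistedBlock_of_snd_eq {X : Type*} {c : Fin (q + 1) → X → Fin q}
    (u v : X) (l : Fin (n ^ 2)) :
    agreement (twistedBlock c O) (u, l) (v, l) = agreement c u v := by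
  simp only [agreement, of_apply]
  refine sum_congr rfl fun s _ => if_congr ?_ rfl rfl
  simp only [twistedBlock, Prod.mk.injEq, and_iff_left_iff_imp]
  intro h
  rw [h]

/-- The two planes meet in q points and the two rows take the prescribed pair of symbols in a single
column. -/
theorem IsNet.twistedBlock {X : Type*} [Fintype X] {c : Fin (q + 1) → X → Fin q}
    (hc : IsNet q c) (hO : IsGroupDivisibleOA n q (q + 1) O) : IsNet q (twistedBlock c O) := by
  classical
  rintro s t hst ⟨a, b⟩ ⟨a', b'⟩
  obtain ⟨l, hl, hl'⟩ := (hO.bijective hst a a').existsUnique (b, b')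
  have : ({v | TwistedLatin.twistedBlock c O s v = (a, b) ∧
      TwistedLatin.twistedBlock c O t v = (a', b')} : Finset (X × Fin (n ^ 2))) =
        ({x | c s x = a ∧ c t x = a'} : Finset X) ×ˢ {l} := by
    ext ⟨x, l'⟩
    simp only [TwistedLatin.twistedBlock, Prod.mk.injEq, mem_filter, mem_univ, true_and,
      mem_product, mem_singleton]
    constructor
    · rintro ⟨⟨rfl, h1⟩, rfl, h2⟩
      exact ⟨⟨rfl, rfl⟩, hl' l' (Prod.ext h1 h2)⟩
    · rintro ⟨⟨rfl, rfl⟩, rfl⟩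
      exact ⟨⟨rfl, congrArg Prod.fst hl⟩, rfl, congrArg Prod.snd hl⟩
  rw [this, card_product, card_singleton, mul_one]
  exact hc s t hst a a'

/-- Between different columns S is already 0 or 1. Inside one column it equals N, which J - N
completes to the all-ones block of a clique. -/
theorem isNetGraph_twistedLatinSquareGraph [Fintype F] (hq : 1 < q) (hn : 0 < n)
    (hcP : ∀ s a x, x ∈ P s a ↔ c s x = a) (hc : IsNet q c)
    (hO : IsGroupDivisibleOA n q (q + 1) O) :
    IsNetGraph q n (twistedLatinSquareGraph P O) (twistedBlock c O)
      ((allOnes (Fin 3 → F) - agreement c) ⊗ₖ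
        (1 : Matrix (Fin (n ^ 2)) (Fin (n ^ 2)) ℝ)) where
  one_lt := hq
  pos := hn
  isNet := hc.twistedBlock hO
  card_eq := by simp
  adjMatrix_add_one := by
    classical
    ext ⟨x, l⟩ ⟨y, l'⟩
    rw [Matrix.add_apply, Matrix.add_apply, SimpleGraph.adjMatrix_apply, kroneckerMap_apply]
    simp only [twistedLatinSquareGraph_adj hcP]
    by_cases hl : l = l'
    · subst hl
      rw [agreement_twistedBlock_of_snd_eq]
      by_cases hxy : x = y
      · subst hxy
        simp
      · simp [hxy]
    · rw [agreement_twistedBlock_of_snd_ne hO hl]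
      simp [hl]
  transpose_eq := by
    rw [← kroneckerMap_transpose, transpose_sub, agreement_transpose, transpose_one]
    rfl
  agreement_mul := by
    classical
    ext ⟨x, l⟩ ⟨y, l'⟩
    simp only [mul_apply, Fintype.sum_prod_type, agreement, of_apply, kroneckerMap_apply,
      Matrix.one_apply, Matrix.smul_apply, allOnes_apply, Matrix.sub_apply, smul_eq_mul]
    simp only [mul_ite, mul_one, mul_zero, sum_ite_eq', mem_univ, if_true, sum_mul]
    rw [sum_comm, mul_sum]
    refine sum_congr rfl fun s _ => ?_
    have key := hc.sum_agree_mul_one_sub_agreement hq s x y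
    simp only [agreement, of_apply] at key
    -- The block of (x, l) meets the layer l' in the whole plane of class s through x or not at all,
    -- which reduces the product to the sum over a plane.
    have hsplit : ∀ z, (if twistedBlock c O s (x, l) = twistedBlock c O s (z, l') then (1 : ℝ)
        else 0) = (if O s (c s x) l = O s (c s x) l' then 1 else 0) *
          if c s x = c s z then 1 else 0 := by
      intro z
      simp only [twistedBlock, Prod.mk.injEq]
      by_cases hz : c s x = c s z
      · simp [← hz]
      · simp [hz]
    simp only [hsplit, mul_assoc, ← mul_sum, key]
    ring_nf
  mul_self := by
    rw [← mul_kronecker_mul, one_mul, hc.one_sub_agreement_mul_self hq, smul_kronecker]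
  trace_eq := by
    rw [trace_kronecker, trace_sub, trace_agreement]
    simp [Matrix.trace]
    ring

/-- Points agreeing in three classes would both lie in the one-point intersection of three planes.
-/
theorem IsPlaneSystem.agreement_mem (hP : IsPlaneSystem q P)
    (hcP : ∀ s a x, x ∈ P s a ↔ c s x = a) {x y : Fin 3 → F} (hxy : x ≠ y) :
    agreement c x y = 0 ∨ agreement c x y = 1 ∨ agreement c x y = 2 := by
  classical
  have : #{s | c s x = c s y} ≤ 2 := by
    by_contra! h
    obtain ⟨h, i, j, hh, hi, hj, hhi, hhj, hij⟩ := two_lt_card_iff.1 h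
    simp only [mem_filter, mem_univ, true_and] at hh hi hj
    exact hxy (hP.eq_of_mem hhi hhj hij
      ⟨(hcP _ _ _).2 hh, (hcP _ _ _).2 hi, (hcP _ _ _).2 hj⟩
      ⟨(hcP _ _ _).2 rfl, (hcP _ _ _).2 rfl, (hcP _ _ _).2 rfl⟩)
  rw [agreement_apply]
  interval_cases #{s | c s x = c s y} <;> simp

theorem level_twistedLatinSquareGraph [Fintype F] (hq : 1 < q) (hn : 2 ≤ n) (hP : IsPlaneSystem q P)
    (hcP : ∀ s a x, x ∈ P s a ↔ c s x = a) (hc : IsNet q c)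
    (hO : IsGroupDivisibleOA n q (q + 1) O) :
    level (twistedLatinSquareGraph P O) = 3 := by
  classical
  have hn0 : 0 < n ^ 2 := by positivity
  let l₀ : Fin (n ^ 2) := ⟨0, hn0⟩
  have hadj : ∀ x y : Fin 3 → F, x ≠ y →
      (twistedLatinSquareGraph P O).Adj (x, l₀) (y, l₀) := by
    intro x y hxy
    rw [twistedLatinSquareGraph_adj hcP]
    exact ⟨by simpa using hxy, Or.inl rfl⟩
  refine (isNetGraph_twistedLatinSquareGraph hq (by omega) hcP hc hO).level_eq_three hn ?_ ?_ ?_ ?_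
  · rintro ⟨x, l⟩ ⟨y, l'⟩ h
    by_cases hl : l = l'
    · subst hl
      rw [agreement_twistedBlock_of_snd_eq]
      exact hP.agreement_mem hcP fun hxy => h.ne (by rw [hxy])
    · rw [agreement_twistedBlock_of_snd_ne hO hl]
      split_ifs <;> simp
  · obtain ⟨y, hxy, h⟩ := hc.exists_agreement_eq_zero hq
      (fun x y hxy => hP.agreement_mem hcP hxy) 0
    exact ⟨(0, l₀), (y, l₀), hadj _ _ hxy, by rw [agreement_twistedBlock_of_snd_eq, h]⟩
  -- Agreement 1: as n < n², some symbol repeats in a row, and vertices in different columns agree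
  -- at most once.
  · obtain ⟨l, l', hl, h⟩ := Fintype.exists_ne_map_eq_of_card_lt (O 0 (c 0 0))
      (by simp only [Fintype.card_fin]; nlinarith)
    have hs : ∃ s, twistedBlock c O s (0, l) = twistedBlock c O s (0, l') :=
      ⟨0, Prod.ext rfl h⟩
    refine ⟨(0, l), (0, l'), ?_, ?_⟩
    · rw [twistedLatinSquareGraph_adj hcP]
      exact ⟨by simpa using hl, Or.inr hs⟩
    · rw [agreement_twistedBlock_of_snd_ne hO hl, if_pos hs]
  -- Agreement 2: take two of the q > 1 points on the intersection of two planes, in the same layer.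
  · have h01 : (0 : Fin (q + 1)) ≠ Fin.last q := by
      rw [Ne, Fin.ext_iff, Fin.val_last, Fin.val_zero]
      omega
    have hcard := hc 0 (Fin.last q) h01 ⟨0, by omega⟩ ⟨0, by omega⟩
    obtain ⟨x, hx, y, hy, hxy⟩ := one_lt_card.1 (hq.trans_eq hcard.symm)
    simp only [mem_filter, mem_univ, true_and] at hx hy
    refine ⟨(x, l₀), (y, l₀), hadj _ _ hxy, ?_⟩
    have h2 : 1 < #{s | c s x = c s y} := one_lt_card.2
      ⟨0, by simp [hx.1, hy.1], Fin.last q, by simp [hx.2, hy.2], h01⟩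
    rw [agreement_twistedBlock_of_snd_eq]
    rcases hP.agreement_mem hcP hxy with h | h | h
    · rw [agreement_apply, Nat.cast_eq_zero] at h
      omega
    · rw [agreement_apply, Nat.cast_eq_one] at h
      omega
    · exact h

end TwistedLatinSquareGraphs

end TwistedLatin

theorem mainTheorem1 (q : ℕ) (hq : IsPrimePow q) (F : Type*) [Field F] [Fintype F]
    (hF : Fintype.card F = q) :
    {n : ℕ | 0 < n ∧
      (∃ P : Fin (q + 1) → Fin q → AffineSubspace F (Fin 3 → F),
        TwistedLatin.IsPlaneSystem q P) ∧
      (∃ O : Fin (q + 1) → Fin q → Fin (n ^ 2) → Fin n,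
        TwistedLatin.IsGroupDivisibleOA n q (q + 1) O)}.Infinite ∧
    ∀ n : ℕ, 0 < n →
      ∀ P : Fin (q + 1) → Fin q → AffineSubspace F (Fin 3 → F),
        TwistedLatin.IsPlaneSystem q P →
      ∀ O : Fin (q + 1) → Fin q → Fin (n ^ 2) → Fin n,
        TwistedLatin.IsGroupDivisibleOA n q (q + 1) O →
      TwistedLatin.IsCoEdgeRegular (TwistedLatin.twistedLatinSquareGraph P O)
        ((q + 1) * q ^ 2) ∧
      (2 ≤ n → TwistedLatin.level (TwistedLatin.twistedLatinSquareGraph P O) = 3) ∧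
      TwistedLatin.spectrum (TwistedLatin.twistedLatinSquareGraph P O) =
        Multiset.replicate 1 ((q : ℝ) ^ 3 - 1 + (q : ℝ) ^ 2 * ((q : ℝ) + 1) * ((n : ℝ) - 1)) +
        Multiset.replicate ((q * n - 1) * (q + 1)) ((q : ℝ) ^ 2 * ((n : ℝ) - 1) - 1) +
        Multiset.replicate ((q - 1) * q ^ 2 * n ^ 2) (-1 : ℝ) +
        Multiset.replicate ((q * n - 1) * (n - 1) * q) (-(q : ℝ) ^ 2 - 1) ∧
      ∀ A : Fin (q + 1) → Fin ((q * n) ^ 2) → Fin (q * n),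
        TwistedLatin.IsOrthogonalArray (q * n) (q + 1) A →
        TwistedLatin.Cospectral (TwistedLatin.twistedLatinSquareGraph P O)
          (TwistedLatin.cliqueExtension q (TwistedLatin.latinSquareGraph A)) := by
  have hq1 : 1 < q := hF ▸ Fintype.one_lt_card
  refine ⟨Set.infinite_of_injective_forall_mem (f := fun k => q ^ k)
    (Nat.pow_right_injective hq1) fun k => ⟨by positivity, TwistedLatin.exists_isPlaneSystem hF,
      TwistedLatin.exists_isGroupDivisibleOA hF q k⟩, ?_⟩
  intro n hn P hP O hO
  obtain ⟨c, hcP, hc⟩ := hP.exists_isNet hF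
  have hG := TwistedLatin.isNetGraph_twistedLatinSquareGraph hq1 hn hcP hc hO
  refine ⟨hG.isCoEdgeRegular ?_, fun hn2 =>
    TwistedLatin.level_twistedLatinSquareGraph hq1 hn2 hP hcP hc hO, hG.spectrum_eq,
    fun A hA => ?_⟩
  · intro u v huv hadj
    rw [TwistedLatin.twistedLatinSquareGraph_adj hcP, not_and, not_or] at hadj
    obtain ⟨h1, h2⟩ := hadj huv
    rw [TwistedLatin.agreement_twistedBlock_of_snd_ne hO h1, if_neg h2]
  · rw [TwistedLatin.Cospectral, hG.spectrum_eq,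
      (TwistedLatin.isNetGraph_cliqueExtension hq1 hn hA).spectrum_eq]
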